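/- All spaces are complex Banach spaces; $B_E$ is the open unit ball of $E$. A Banach operator ideal $\mathcal A$ assigns to every pair of Banach spaces a linear subspace $\mathcal A(Z;X)$ of the bounded operators $\mathcal L(Z;X)$ which contains the finite rank operators, is stable under composition with bounded operators on either side, and carries a complete norm with $\|\mathrm{id}_{\mathbb C}\|_{\mathcal A}=1$ and $\|T\circ S\circ R\|_{\mathcal A}\le\|T\|\,\|S\|_{\mathcal A}\,\|R\|$. A set $K\subset X$ is relatively $\mathcal A$-compact if there are a Banach space $Z$, an operator $T\in\mathcal A(Z;X)$ and a compact set $M\subset Z$ with $K\subset T(M)$. An operator $T\in\mathcal L(Z;X)$ is $\mathcal A$-compact if $T(B_Z)$ is relatively $\mathcal A$-compact. A continuous $n$-homogeneous polynomial $P\colon E\to X$ is $\mathcal A$-compact if there are a Banach space $Z$ and an $\mathcal A$-compact operator $T\in\mathcal L(Z;X)$ with $P(B_E)\subset T(B_Z)$. A holomorphic map $f\colon E\to X$ is $\mathcal A$-compact at $x\in E$ if $f(x+\varepsilon B_E)$ is relatively $\mathcal A$-compact for some $\varepsilon>0$. Let $\mathcal H_{\mathcal K_{\mathcal A}}(E;X)$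 be the set of holomorphic maps $f\colon E\to X$ that are $\mathcal A$-compact at every point of $E$, and $\mathcal H^{\mathcal P}_{\mathcal K_{\mathcal A}}(E;X)$ the set of holomorphic maps $f\colon E\to X$ such that for all $x\in E$ and all $n\ge 0$ the $n$-th polynomial $P_nf(x)$ of the Taylor series of $f$ at $x$ is $\mathcal A$-compact. Let $X$ be a Banach space and let $\mathcal A$, $\mathcal B$ be Banach operator ideals such that some subset of $X$ is relatively $\mathcal B$-compact but not relatively $\mathcal A$-compact. Then there is a map $f\in\mathcal H_{\mathcal K_{\mathcal B}}(\ell_1;X)\cap\mathcal H^{\mathcal P}_{\mathcal K_{\mathcal A}}(\ell_1;X)$ which is not $\mathcal A$-compact at any point of $\ell_1$. In particular, $\mathcal H_{\mathcal K_{\mathcal A}}(\ell_1;X)\subsetneq\mathcal H^{\mathcal P}_{\mathcal K_{\mathcal A}}(\ell_1;X)$. -/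

import Mathlib

open Filter Topology Metric

universe u v

/-- A Banach operator ideal on the class of all complex Banach spaces (in the universe `u`):
for all Banach spaces `X`, `Y` a linear subspace `mem X Y` of the bounded operators from `X` to `Y`,
containing the operators of finite rank and stable under composition with bounded operators on both
sides, and a complete norm `nrm X Y` on this subspace which is `1` at the identity of the scalar
field (lifted to the universe `u`) and satisfies `‖T ∘ S ∘ R‖_A ≤ ‖T‖ ‖S‖_A ‖R‖`. -/
structure BanachOperatorIdeal where
  /-- the component of the ideal formed by the operators from `X` to `Y` -/
  mem : ∀ (X Y : Type u) [NormedAddCommGroup X] [NormedSpace ℂ X] [CompleteSpace X]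
    [NormedAddCommGroup Y] [NormedSpace ℂ Y] [CompleteSpace Y], Submodule ℂ (X →L[ℂ] Y)
  /-- the ideal norm -/
  nrm : ∀ (X Y : Type u) [NormedAddCommGroup X] [NormedSpace ℂ X] [CompleteSpace X]
    [NormedAddCommGroup Y] [NormedSpace ℂ Y] [CompleteSpace Y], Seminorm ℂ (mem X Y)
  finiteRank_mem : ∀ (X Y : Type u) [NormedAddCommGroup X] [NormedSpace ℂ X] [CompleteSpace X]
    [NormedAddCommGroup Y] [NormedSpace ℂ Y] [CompleteSpace Y] (T : X →L[ℂ] Y),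
    FiniteDimensional ℂ (LinearMap.range (T : X →ₗ[ℂ] Y)) → T ∈ mem X Y
  comp_mem : ∀ (W X Y V : Type u) [NormedAddCommGroup W] [NormedSpace ℂ W] [CompleteSpace W]
    [NormedAddCommGroup X] [NormedSpace ℂ X] [CompleteSpace X]
    [NormedAddCommGroup Y] [NormedSpace ℂ Y] [CompleteSpace Y]
    [NormedAddCommGroup V] [NormedSpace ℂ V] [CompleteSpace V]
    (T : Y →L[ℂ] V) (S : X →L[ℂ] Y) (R : W →L[ℂ] X),
    S ∈ mem X Y → (T.comp S).comp R ∈ mem W V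
  nrm_eq_zero : ∀ (X Y : Type u) [NormedAddCommGroup X] [NormedSpace ℂ X] [CompleteSpace X]
    [NormedAddCommGroup Y] [NormedSpace ℂ Y] [CompleteSpace Y] (S : mem X Y),
    nrm X Y S = 0 → S = 0
  nrm_complete : ∀ (X Y : Type u) [NormedAddCommGroup X] [NormedSpace ℂ X] [CompleteSpace X]
    [NormedAddCommGroup Y] [NormedSpace ℂ Y] [CompleteSpace Y] (S : ℕ → mem X Y),
    (∀ ε : ℝ, 0 < ε → ∃ N : ℕ, ∀ m n : ℕ, N ≤ m → N ≤ n → nrm X Y (S m - S n) < ε) →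
    ∃ L : mem X Y, Tendsto (fun n => nrm X Y (S n - L)) atTop (𝓝 0)
  nrm_id : ∀ h : ContinuousLinearMap.id ℂ (ULift.{u} ℂ) ∈ mem (ULift.{u} ℂ) (ULift.{u} ℂ),
    nrm (ULift.{u} ℂ) (ULift.{u} ℂ) ⟨ContinuousLinearMap.id ℂ (ULift.{u} ℂ), h⟩ = 1
  nrm_comp_le : ∀ (W X Y V : Type u) [NormedAddCommGroup W] [NormedSpace ℂ W] [CompleteSpace W]
    [NormedAddCommGroup X] [NormedSpace ℂ X] [CompleteSpace X]
    [NormedAddCommGroup Y] [NormedSpace ℂ Y] [CompleteSpace Y]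
    [NormedAddCommGroup V] [NormedSpace ℂ V] [CompleteSpace V]
    (T : Y →L[ℂ] V) (S : mem X Y) (R : W →L[ℂ] X),
    nrm W V ⟨(T.comp (S : X →L[ℂ] Y)).comp R, comp_mem W X Y V T S R S.2⟩ ≤
      ‖T‖ * nrm X Y S * ‖R‖

/-- A function of the form `x ↦ U (x, …, x)` with `U` continuous and `n`-linear. -/
def IsContHomPolynomial {E F : Type*} [NormedAddCommGroup E] [NormedSpace ℂ E]
    [NormedAddCommGroup F] [NormedSpace ℂ F] (n : ℕ) (P : E → F) : Prop :=
  ∃ U : E [×n]→L[ℂ] F, ∀ x : E, P x = U (fun _ => x)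

/-- The `n`-th polynomial `P_n f(x₀)` of the Taylor series expansion of `f` at `x₀`. -/
noncomputable def taylorPolynomial {E F : Type*} [NormedAddCommGroup E] [NormedSpace ℂ E]
    [NormedAddCommGroup F] [NormedSpace ℂ F] (f : E → F) (x₀ : E) (n : ℕ) : E → F :=
  fun y => ((n.factorial : ℂ)⁻¹) • iteratedFDeriv ℂ n f x₀ (fun _ => y)

/-- If `f(x₀ + y) = ∑ p_n(y, …, y)` near `x₀`, then `P_n f(x₀)(y) = p_n(y, …, y)`. -/
theorem taylorPolynomial_eq_of_hasFPowerSeriesAt {E F : Type*}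
    [NormedAddCommGroup E] [NormedSpace ℂ E] [NormedAddCommGroup F] [NormedSpace ℂ F]
    [CompleteSpace F] {f : E → F} {x₀ : E} {p : FormalMultilinearSeries ℂ E F}
    (h : HasFPowerSeriesAt f p x₀) (n : ℕ) (y : E) :
    taylorPolynomial f x₀ n y = p n (fun _ => y) := by
  obtain ⟨r, hr⟩ := h
  have h1 := hr.factorial_smul y n
  have h2 : (n.factorial : ℂ) ≠ 0 := by exact_mod_cast n.factorial_ne_zero
  rw [taylorPolynomial, ← h1, ← Nat.cast_smul_eq_nsmul ℂ, smul_smul, inv_mul_cancel₀ h2, one_smul]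

namespace BanachOperatorIdeal

/-- Relatively `A`-compact sets: `K ⊆ T(M)` for some `T ∈ A(Z; X)` and some compact `M ⊆ Z`. -/
def RelCompact (A : BanachOperatorIdeal.{u}) {X : Type u} [NormedAddCommGroup X]
    [NormedSpace ℂ X] [CompleteSpace X] (K : Set X) : Prop :=
  ∃ (Z : Type u) (_ : NormedAddCommGroup Z) (_ : NormedSpace ℂ Z) (_ : CompleteSpace Z)
    (T : Z →L[ℂ] X) (M : Set Z), T ∈ A.mem Z X ∧ IsCompact M ∧ K ⊆ T '' M

/-- `A`-compact operators, i.e. the operators in `K_A`. -/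
def CompactOperator (A : BanachOperatorIdeal.{u}) {Z : Type v} {X : Type u}
    [NormedAddCommGroup Z] [NormedSpace ℂ Z]
    [NormedAddCommGroup X] [NormedSpace ℂ X] [CompleteSpace X] (T : Z →L[ℂ] X) : Prop :=
  A.RelCompact (T '' ball 0 1)

/-- `K_A`-bounded sets: `K ⊆ T(B_Z)` for some `A`-compact operator `T` on a Banach space `Z`. -/
def KBounded (A : BanachOperatorIdeal.{u}) {X : Type u} [NormedAddCommGroup X]
    [NormedSpace ℂ X] [CompleteSpace X] (K : Set X) : Prop :=
  ∃ (Z : Type u) (_ : NormedAddCommGroup Z) (_ : NormedSpace ℂ Z) (_ : CompleteSpace Z)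
    (T : Z →L[ℂ] X), A.CompactOperator T ∧ K ⊆ T '' ball 0 1

/-- `A`-compact `n`-homogeneous polynomials: those which are `K_A`-bounded on the unit ball. -/
def compactPolynomials (A : BanachOperatorIdeal.{u}) (n : ℕ) (E : Type v) (X : Type u)
    [NormedAddCommGroup E] [NormedSpace ℂ E]
    [NormedAddCommGroup X] [NormedSpace ℂ X] [CompleteSpace X] : Set (E → X) :=
  {P | IsContHomPolynomial n P ∧ A.KBounded (P '' ball 0 1)}

/-- `f` is `A`-compact at `x`. -/
def CompactAt (A : BanachOperatorIdeal.{u}) {E : Type v} {X : Type u}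
    [NormedAddCommGroup E] [NormedAddCommGroup X] [NormedSpace ℂ X] [CompleteSpace X]
    (f : E → X) (x : E) : Prop :=
  ∃ ε : ℝ, 0 < ε ∧ A.RelCompact (f '' ball x ε)

/-- `H_{K_A}(E; X)`: the entire maps which are `A`-compact at every point. -/
def compactHolomorphic (A : BanachOperatorIdeal.{u}) (E : Type v) (X : Type u)
    [NormedAddCommGroup E] [NormedSpace ℂ E]
    [NormedAddCommGroup X] [NormedSpace ℂ X] [CompleteSpace X] : Set (E → X) :=
  {f | AnalyticOnNhd ℂ f Set.univ ∧ ∀ x : E, A.CompactAt f x}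

/-- `H^P_{K_A}(E; X)`: the entire maps all of whose Taylor polynomials, at every point, are
`A`-compact. -/
def polyCompactHolomorphic (A : BanachOperatorIdeal.{u}) (E : Type v) (X : Type u)
    [NormedAddCommGroup E] [NormedSpace ℂ E]
    [NormedAddCommGroup X] [NormedSpace ℂ X] [CompleteSpace X] : Set (E → X) :=
  {f | AnalyticOnNhd ℂ f Set.univ ∧
    ∀ (x : E) (n : ℕ), taylorPolynomial f x n ∈ A.compactPolynomials n E X}

end BanachOperatorIdeal

/-!
Let `K ⊆ T(M)` be relatively `B`-compact but not relatively `A`-compact, with `T ∈ B(Z; X)` and `M`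
compact. Grothendieck's lemma (`IsCompact.exists_null_seq`) puts `M` into the absolutely convex
closed hull of a null sequence `zⱼ`, so that already `{T zⱼ}` is not relatively `A`-compact:
relatively `A`-compact sets have relatively `A`-compact absolutely convex closed hulls
(`RelCompact.exists_disk`).

Choose exponents `nⱼ → ∞` growing so slowly that still `nⱼ ^ nⱼ zⱼ → 0`, put `vⱼ = nⱼ ^ nⱼ T zⱼ`, and
let `f(a) = ∑ aⱼ ^ nⱼ vⱼ` on `ℓ₁`.

* Since `nⱼ → ∞` and `aⱼ → 0`, the sequence `aⱼ ^ nⱼ` is locally bounded in `ℓ₁`. Hence `f` is entire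
  (`hasFPowerSeriesOnBall_powerSum`), and locally its values lie in a multiple of the closed
  absolutely convex hull of `{vⱼ}`, which is relatively `B`-compact (`compactAt_powerSum`).
* The `k`-th Taylor polynomial at `x` is `∑ (nⱼ choose k) xⱼ ^ (nⱼ - k) yⱼ ^ k vⱼ`. For fixed `k` and
  `x` the coefficients `cⱼ` of `yⱼ ^ k vⱼ` have `∑ √|cⱼ| < ∞`, and then `{cⱼ vⱼ}` is the image of a
  null sequence under a nuclear operator, hence relatively `A`-compact for every ideal `A`
  (`relCompact_range_smul`, `powerSum_mem_polyCompactHolomorphic`).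
* A change of the `j`-th coordinate of `x` by `ε / 2` changes `f(x)` by a multiple of `T zⱼ` with
  factor at least `(ε nⱼ / 8) ^ nⱼ ≥ 1` for large `j`. So if `f` were `A`-compact at `x`, then `{T zⱼ}`
  would be relatively `A`-compact (`not_compactAt_powerSum`).

The inclusion of the two spaces of holomorphic maps is Cauchy's formula: the values of a Taylor
polynomial on the unit ball are averages of multiples of values of the map on a small ball
(`taylorPolynomial_mem`).
-/

/-! ### Disks and relatively `A`-compact sets -/

section Disks

variable {Z : Type*} [NormedAddCommGroup Z] [NormedSpace ℂ Z]

theorem Balanced.convexHull_real {s : Set Z} (hs : Balanced ℂ s) :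
    Balanced ℂ (convexHull ℝ s) := by
  rw [balanced_iff_smul_mem]
  intro a ha x hx
  have hc : Convex ℝ {y : Z | a • y ∈ convexHull ℝ s} := by
    intro y hy z hz p q hp hq hpq
    have := convex_convexHull ℝ s hy hz hp hq hpq
    rw [smul_comm p a, smul_comm q a, ← smul_add] at this
    exact this
  have hsub : s ⊆ {y : Z | a • y ∈ convexHull ℝ s} := fun y hy =>
    subset_convexHull ℝ s (hs.smul_mem ha hy)
  exact convexHull_min hsub hc hx

/-- The closed convex hull of the balanced hull. Convexity refers to real and balancedness to
complex scalars. -/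
theorem IsCompact.exists_compact_disk [CompleteSpace Z] {M : Set Z} (hM : IsCompact M) :
    ∃ D : Set Z, M ⊆ D ∧ IsCompact D ∧ Convex ℝ D ∧ Balanced ℂ D := by
  have hB : IsCompact (balancedHull ℂ M) := by
    have : balancedHull ℂ M = (fun p : ℂ × Z => p.1 • p.2) '' (closedBall (0 : ℂ) 1 ×ˢ M) := by
      ext x
      simp only [mem_balancedHull_iff, Set.mem_smul_set, Set.mem_image, Set.mem_prod, Prod.exists,
        mem_closedBall, dist_zero_right]
      constructor
      · rintro ⟨r, hr, y, hy, rfl⟩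
        exact ⟨r, y, ⟨hr, hy⟩, rfl⟩
      · rintro ⟨r, y, ⟨hr, hy⟩, rfl⟩
        exact ⟨r, hr, y, hy, rfl⟩
    rw [this]
    exact ((isCompact_closedBall _ _).prod hM).image (by fun_prop)
  refine ⟨closure (convexHull ℝ (balancedHull ℂ M)), ?_, ?_, ?_, ?_⟩
  · exact (subset_balancedHull ℂ).trans ((subset_convexHull ℝ _).trans subset_closure)
  · exact isCompact_closure_of_totallyBounded_quasiComplete (𝕜 := ℝ)
      (totallyBounded_convexHull.2 hB.totallyBounded)
  · exact (convex_convexHull ℝ _).closure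
  · exact (balancedHull.balanced M).convexHull_real.closure

theorem Balanced.sum_smul_mem {ι : Type*} {D : Set Z} (hb : Balanced ℂ D) (hc : Convex ℝ D)
    (hne : D.Nonempty) (s : Finset ι) (a : ι → ℂ) (v : ι → Z) (hv : ∀ i ∈ s, v i ∈ D)
    (ha : ∑ i ∈ s, ‖a i‖ ≤ 1) : ∑ i ∈ s, a i • v i ∈ D := by
  rcases (Finset.sum_nonneg fun i (_ : i ∈ s) => norm_nonneg (a i)).eq_or_lt with h0 | h0
  · have : ∀ i ∈ s, a i • v i = 0 := fun i hi => by
      rw [norm_eq_zero.1 ((Finset.sum_eq_zero_iff_of_nonneg fun i _ => norm_nonneg (a i)).1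
        h0.symm i hi), zero_smul]
    rw [Finset.sum_eq_zero this]
    exact hb.zero_mem hne
  · -- normalise the coefficients to a convex combination of unimodular multiples of the `v i`
    have h1 := hc.centerMass_mem (t := s) (w := fun i => ‖a i‖)
      (z := fun i => (a i / ‖a i‖) • v i) (fun i _ => norm_nonneg _) h0
      (fun i hi => hb.smul_mem (by
        rw [norm_div, Complex.norm_real, norm_norm]; exact div_self_le_one _) (hv i hi))
    have h2 := hb.smul_mem (a := ((∑ i ∈ s, ‖a i‖ : ℝ) : ℂ))
      (by rwa [Complex.norm_real, Real.norm_of_nonneg h0.le]) h1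
    convert! h2 using 1
    rw [Finset.centerMass, Complex.coe_smul, smul_inv_smul₀ h0.ne']
    refine Finset.sum_congr rfl fun i _ => ?_
    rw [← Complex.coe_smul, smul_smul]
    by_cases hi : a i = 0
    · simp [hi]
    · rw [mul_div_cancel₀ _ (by simpa using hi)]

theorem Balanced.hasSum_smul_mem {ι : Type*} {D : Set Z} (hb : Balanced ℂ D) (hc : Convex ℝ D)
    (hcl : IsClosed D) (hne : D.Nonempty) {a : ι → ℂ} {v : ι → Z} (hv : ∀ i, v i ∈ D)
    (ha : ∀ s : Finset ι, ∑ i ∈ s, ‖a i‖ ≤ 1) {x : Z} (hx : HasSum (fun i => a i • v i) x) :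
    x ∈ D :=
  hcl.mem_of_tendsto hx (Eventually.of_forall fun s =>
    hb.sum_smul_mem hc hne s a v (fun i _ => hv i) (ha s))

end Disks

namespace BanachOperatorIdeal

variable {A : BanachOperatorIdeal.{u}} {X : Type u} [NormedAddCommGroup X] [NormedSpace ℂ X]
  [CompleteSpace X]

theorem RelCompact.mono {K L : Set X} (hL : A.RelCompact L) (h : K ⊆ L) : A.RelCompact K := by
  obtain ⟨Z, _, _, _, T, M, hT, hM, hK⟩ := hL
  exact ⟨Z, _, _, _, T, M, hT, hM, h.trans hK⟩

/-- The image of a compact disk is again a compact disk, so that the hull can be taken in the domain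
of the operator. -/
theorem RelCompact.exists_disk {K : Set X} (hK : A.RelCompact K) :
    ∃ D : Set X, K ⊆ D ∧ A.RelCompact D ∧ IsClosed D ∧ Convex ℝ D ∧ Balanced ℂ D := by
  obtain ⟨Z, _, _, _, T, M, hT, hM, hK⟩ := hK
  obtain ⟨D, hMD, hD, hc, hb⟩ := hM.exists_compact_disk
  refine ⟨T '' D, hK.trans (Set.image_mono hMD), ⟨Z, _, _, _, T, D, hT, hD, subset_rfl⟩,
    (hD.image T.continuous).isClosed, ?_, ?_⟩
  · exact hc.linear_image (T.restrictScalars ℝ).toLinearMap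
  · rw [balanced_iff_smul_mem] at hb ⊢
    rintro a ha _ ⟨x, hx, rfl⟩
    exact ⟨a • x, hb ha hx, map_smul T a x⟩

theorem RelCompact.image_smul {K : Set X} (hK : A.RelCompact K) (c : ℂ) :
    A.RelCompact ((fun x => c • x) '' K) := by
  obtain ⟨Z, _, _, _, T, M, hT, hM, hK⟩ := hK
  refine ⟨Z, _, _, _, T, (fun x => c • x) '' M, hT, hM.image (continuous_const_smul c), ?_⟩
  rintro _ ⟨x, hx, rfl⟩
  obtain ⟨y, hy, rfl⟩ := hK hx
  exact ⟨c • y, ⟨y, hy, rfl⟩, map_smul T c y⟩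

theorem comp_left_mem {Z V : Type u} [NormedAddCommGroup Z] [NormedSpace ℂ Z] [CompleteSpace Z]
    [NormedAddCommGroup V] [NormedSpace ℂ V] [CompleteSpace V] {S : V →L[ℂ] X}
    (hS : S ∈ A.mem V X) (R : Z →L[ℂ] V) : S.comp R ∈ A.mem Z X := by
  simpa using A.comp_mem Z V X X (ContinuousLinearMap.id ℂ X) S R hS

theorem RelCompact.union {K L : Set X} (hK : A.RelCompact K) (hL : A.RelCompact L) :
    A.RelCompact (K ∪ L) := by
  obtain ⟨Z, _, _, _, T, M, hT, hM, hK⟩ := hK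
  obtain ⟨W, _, _, _, S, N, hS, hN, hL⟩ := hL
  refine ⟨Z × W, inferInstance, inferInstance, inferInstance,
    T.comp (ContinuousLinearMap.fst ℂ Z W) + S.comp (ContinuousLinearMap.snd ℂ Z W),
    insert 0 M ×ˢ insert 0 N, ?_, (hM.insert 0).prod (hN.insert 0), ?_⟩
  · exact add_mem (comp_left_mem hT _) (comp_left_mem hS _)
  · rintro x (hx | hx)
    · obtain ⟨y, hy, rfl⟩ := hK hx
      exact ⟨(y, 0), ⟨by simp [hy], by simp⟩, by simp⟩
    · obtain ⟨y, hy, rfl⟩ := hL hx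
      exact ⟨(0, y), ⟨by simp, by simp [hy]⟩, by simp⟩

theorem smulRight_mem {Z : Type u} [NormedAddCommGroup Z] [NormedSpace ℂ Z] [CompleteSpace Z]
    (φ : Z →L[ℂ] ℂ) (x : X) : φ.smulRight x ∈ A.mem Z X := by
  apply A.finiteRank_mem
  refine Submodule.finiteDimensional_of_le (S₂ := ℂ ∙ x) ?_
  rintro _ ⟨z, rfl⟩
  exact Submodule.smul_mem _ _ (Submodule.mem_span_singleton_self x)

theorem relCompact_singleton (x : X) : A.RelCompact {x} := by
  refine ⟨ULift.{u} ℂ, inferInstance, inferInstance, inferInstance, _, {ULift.up 1},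
    smulRight_mem (ContinuousLinearEquiv.ulift : ULift.{u} ℂ ≃L[ℂ] ℂ).toContinuousLinearMap x,
    isCompact_singleton, ?_⟩
  rintro _ rfl
  exact ⟨_, rfl, one_smul ℂ _⟩

theorem relCompact_of_finite {K : Set X} (hK : K.Finite) : A.RelCompact K := by
  induction K, hK using Set.Finite.induction_on with
  | empty => exact (relCompact_singleton (0 : X)).mono (Set.empty_subset _)
  | insert _ _ ih => exact ((relCompact_singleton _).union ih).mono (Set.insert_eq _ _).le

theorem relCompact_range_of_tendsto {Z : Type u} [NormedAddCommGroup Z] [NormedSpace ℂ Z]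
    [CompleteSpace Z] {T : Z →L[ℂ] X} (hT : T ∈ A.mem Z X) {w : ℕ → Z}
    (hw : Tendsto w atTop (𝓝 0)) : A.RelCompact (Set.range fun j => T (w j)) := by
  refine ⟨Z, _, _, _, T, insert 0 (Set.range w), hT, hw.isCompact_insert_range, ?_⟩
  rintro _ ⟨j, rfl⟩
  exact ⟨w j, by simp, rfl⟩

end BanachOperatorIdeal

/-! ### Nuclear operators -/

namespace BanachOperatorIdeal

section Scalars

variable {X Z : Type u} [NormedAddCommGroup X] [NormedSpace ℂ X] [NormedAddCommGroup Z]
  [NormedSpace ℂ Z]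

/-- The operator `c ↦ c • x` from the scalar field, lifted to the universe `u`. -/
noncomputable def fromScalars (x : X) : ULift.{u} ℂ →L[ℂ] X :=
  (ContinuousLinearMap.toSpanSingleton ℂ x).comp
    (ContinuousLinearEquiv.ulift : ULift.{u} ℂ ≃L[ℂ] ℂ).toContinuousLinearMap

/-- A functional, with values in the scalar field lifted to the universe `u`. -/
noncomputable def toScalars (φ : Z →L[ℂ] ℂ) : Z →L[ℂ] ULift.{u} ℂ :=
  (ContinuousLinearEquiv.ulift : ULift.{u} ℂ ≃L[ℂ] ℂ).symm.toContinuousLinearMap.comp φ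

theorem norm_fromScalars_le (x : X) : ‖fromScalars x‖ ≤ ‖x‖ :=
  (fromScalars x).opNorm_le_bound (norm_nonneg _) fun c =>
    ((norm_smul c.down x).trans (mul_comm _ _)).le

theorem norm_toScalars_le (φ : Z →L[ℂ] ℂ) : ‖toScalars φ‖ ≤ ‖φ‖ :=
  (toScalars φ).opNorm_le_bound (norm_nonneg _) fun z => φ.le_opNorm z

end Scalars

variable {A : BanachOperatorIdeal.{u}} {X Z : Type u} [NormedAddCommGroup X] [NormedSpace ℂ X]
  [CompleteSpace X] [NormedAddCommGroup Z] [NormedSpace ℂ Z] [CompleteSpace Z]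

theorem id_scalars_mem (A : BanachOperatorIdeal.{u}) :
    ContinuousLinearMap.id ℂ (ULift.{u} ℂ) ∈ A.mem (ULift.{u} ℂ) (ULift.{u} ℂ) :=
  A.finiteRank_mem _ _ _
    (Module.Finite.range (ContinuousLinearMap.id ℂ (ULift.{u} ℂ)).toLinearMap)

theorem nrm_smulRight_le (φ : Z →L[ℂ] ℂ) (x : X) :
    A.nrm Z X ⟨φ.smulRight x, smulRight_mem φ x⟩ ≤ ‖φ‖ * ‖x‖ := by
  have h := A.nrm_comp_le Z (ULift.{u} ℂ) (ULift.{u} ℂ) X (fromScalars x)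
    ⟨_, A.id_scalars_mem⟩ (toScalars φ)
  rw [A.nrm_id A.id_scalars_mem, mul_one] at h
  refine (le_of_eq_of_le rfl h).trans ?_
  rw [mul_comm ‖φ‖]
  exact mul_le_mul (norm_fromScalars_le x) (norm_toScalars_le φ) (norm_nonneg _) (norm_nonneg _)

/-- The ideal norm dominates the operator norm. -/
theorem norm_apply_le_nrm (T : A.mem Z X) (z : Z) :
    ‖(T : Z →L[ℂ] X) z‖ ≤ A.nrm Z X T * ‖z‖ := by
  set x := (T : Z →L[ℂ] X) z with hx
  -- for `φ` norming `x`, the operator `c ↦ φ (T (c • z))` is `‖x‖` times the identity of `ℂ`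
  obtain ⟨φ, hφ, hφx⟩ := exists_dual_vector'' ℂ x
  have h := A.nrm_comp_le (ULift.{u} ℂ) Z X (ULift.{u} ℂ) (toScalars φ) T (fromScalars z)
  have heq : (⟨((toScalars φ).comp (T : Z →L[ℂ] X)).comp (fromScalars z),
      A.comp_mem _ _ _ _ (toScalars φ) T (fromScalars z) T.2⟩ :
      A.mem (ULift.{u} ℂ) (ULift.{u} ℂ)) = (‖x‖ : ℂ) • ⟨_, A.id_scalars_mem⟩ := by
    ext c
    change φ ((T : Z →L[ℂ] X) (c.down • z)) = (‖x‖ : ℂ) • c.down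
    rw [map_smul, ← hx, map_smul, hφx, smul_eq_mul, smul_eq_mul, mul_comm]
    rfl
  rw [heq, map_smul_eq_mul, A.nrm_id A.id_scalars_mem, mul_one, Complex.norm_real, norm_norm] at h
  have h0 : 0 ≤ A.nrm Z X T := apply_nonneg _ _
  calc ‖x‖ ≤ ‖toScalars φ‖ * A.nrm Z X T * ‖fromScalars z‖ := h
    _ ≤ 1 * A.nrm Z X T * ‖z‖ := by
      gcongr
      exacts [(norm_toScalars_le φ).trans hφ, norm_fromScalars_le z]
    _ = _ := by rw [one_mul]

/-- Nuclear operators belong to every Banach operator ideal. -/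
theorem mem_of_hasSum {φ : ℕ → Z →L[ℂ] ℂ} (hφ : ∀ j, ‖φ j‖ ≤ 1) {x : ℕ → X}
    (hx : Summable fun j => ‖x j‖) {T : Z →L[ℂ] X}
    (hT : ∀ z, HasSum (fun j => φ j z • x j) (T z)) : T ∈ A.mem Z X := by
  let R : ℕ → A.mem Z X := fun j => ⟨(φ j).smulRight (x j), smulRight_mem _ _⟩
  have hR : ∀ j, A.nrm Z X (R j) ≤ ‖x j‖ := fun j =>
    (nrm_smulRight_le _ _).trans (mul_le_of_le_one_left (norm_nonneg _) (hφ j))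
  let S : ℕ → A.mem Z X := fun n => ∑ j ∈ Finset.range n, R j
  have hS : ∀ m n, m ≤ n → A.nrm Z X (S n - S m) ≤ ∑ j ∈ Finset.Ico m n, ‖x j‖ := by
    intro m n hmn
    rw [← Finset.sum_Ico_eq_sub R hmn]
    refine (Finset.le_sum_of_subadditive (A.nrm Z X) (map_zero _).le (map_add_le_add _) _ _).trans ?_
    exact Finset.sum_le_sum fun j _ => hR j
  obtain ⟨L, hL⟩ := A.nrm_complete Z X S (by
    intro ε hε
    obtain ⟨N, hN⟩ := Metric.cauchySeq_iff.1 hx.hasSum.tendsto_sum_nat.cauchySeq ε hε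
    have key : ∀ m n, N ≤ m → m ≤ n → A.nrm Z X (S n - S m) < ε := by
      intro m n hm hmn
      refine (hS m n hmn).trans_lt ?_
      have := hN n (hm.trans hmn) m hm
      rw [Real.dist_eq, ← Finset.sum_Ico_eq_sub _ hmn] at this
      exact (le_abs_self _).trans_lt this
    refine ⟨N, fun m n hm hn => ?_⟩
    rcases le_total m n with h | h
    · rw [map_sub_rev]
      exact key m n hm h
    · exact key n m hn h)
  have : T = L := by
    ext z
    refine tendsto_nhds_unique (hT z).tendsto_sum_nat ?_
    rw [tendsto_iff_norm_sub_tendsto_zero]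
    refine squeeze_zero (fun _ => norm_nonneg _) (fun n => ?_)
      (by simpa using hL.mul_const ‖z‖)
    convert! norm_apply_le_nrm (S n - L) z using 2
    simp [S, R]
  rw [this]
  exact L.2

end BanachOperatorIdeal

/-! ### `ℓ₁` and null sequences -/

theorem lp.hasSum_norm_one (a : lp (fun _ : ℕ => ℂ) 1) : HasSum (fun j => ‖a j‖) ‖a‖ := by
  simpa using lp.hasSum_norm (p := 1) (by simp) a

section Series

variable {Z : Type*} [NormedAddCommGroup Z] [NormedSpace ℂ Z]

theorem Balanced.hasSum_lp_mem {D : Set Z} (hb : Balanced ℂ D) (hc : Convex ℝ D)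
    (hcl : IsClosed D) {v : ℕ → Z} (hv : ∀ j, v j ∈ D) {a : lp (fun _ : ℕ => ℂ) 1}
    (ha : ‖a‖ ≤ 1) {x : Z} (hx : HasSum (fun j => a j • v j) x) : x ∈ D :=
  hb.hasSum_smul_mem hc hcl ⟨_, hv 0⟩ hv (fun s =>
    (sum_le_hasSum s (fun _ _ => norm_nonneg _) (lp.hasSum_norm_one a)).trans ha) hx

theorem lp.summable_norm_smul (a : lp (fun _ : ℕ => ℂ) 1) {v : ℕ → Z} {C : ℝ}
    (hv : ∀ j, ‖v j‖ ≤ C) : Summable fun j => ‖a j • v j‖ := by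
  refine ((lp.hasSum_norm_one a).summable.mul_right C).of_nonneg_of_le
    (fun _ => norm_nonneg _) fun j => ?_
  rw [norm_smul]
  exact mul_le_mul_of_nonneg_left (hv j) (norm_nonneg _)

variable [CompleteSpace Z]

/-- The operator `a ↦ ∑ aⱼ vⱼ` from `ℓ₁` given by a bounded sequence `v`. -/
noncomputable def lp.sumSMul (v : ℕ → Z) (C : ℝ) (hv : ∀ j, ‖v j‖ ≤ C) :
    lp (fun _ : ℕ => ℂ) 1 →L[ℂ] Z :=
  LinearMap.mkContinuous
    { toFun := fun a => ∑' j, a j • v j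
      map_add' := fun a b => by
        rw [← (lp.summable_norm_smul a hv).of_norm.tsum_add (lp.summable_norm_smul b hv).of_norm]
        exact tsum_congr fun j => add_smul _ _ _
      map_smul' := fun c a => by
        rw [RingHom.id_apply, ← (lp.summable_norm_smul a hv).of_norm.tsum_const_smul]
        exact tsum_congr fun j => mul_smul _ _ _ }
    C fun a => by
      refine tsum_of_norm_bounded ((lp.hasSum_norm_one a).mul_left C) fun j => ?_
      rw [norm_smul, mul_comm]
      exact mul_le_mul_of_nonneg_right (hv j) (norm_nonneg _)

theorem lp.hasSum_sumSMul {v : ℕ → Z} {C : ℝ} (hv : ∀ j, ‖v j‖ ≤ C)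
    (a : lp (fun _ : ℕ => ℂ) 1) : HasSum (fun j => a j • v j) (lp.sumSMul v C hv a) :=
  (lp.summable_norm_smul a hv).of_norm.hasSum

end Series

section Grothendieck

/-- Finite sets of vectors whose norms tend to zero can be listed in one null sequence, with the
elements of the `i`-th set at places `Nat.pair i l`. -/
theorem exists_null_enumeration {Z : Type*} [NormedAddCommGroup Z] {F : ℕ → Set Z}
    (hF : ∀ i, (F i).Finite) {r : ℕ → ℝ}
    (hr : Tendsto r atTop (𝓝 0)) (hFr : ∀ i, ∀ y ∈ F (i + 1), ‖y‖ ≤ r i) :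
    ∃ z : ℕ → Z, Tendsto z atTop (𝓝 0) ∧ ∀ i, ∀ y ∈ F i, ∃ l, z (Nat.pair i l) = y := by
  classical
  let L : ℕ → List Z := fun i => (hF i).toFinset.toList
  let v : ℕ → ℕ → Z := fun i l => (L i).getD l 0
  have hv : ∀ i l, v i l = 0 ∨ v i l ∈ F i := by
    intro i l
    by_cases hl : l < (L i).length
    · right
      have : v i l = (L i)[l] := List.getD_eq_getElem _ _ hl
      rw [this, ← (hF i).mem_toFinset, ← Finset.mem_toList]
      exact List.getElem_mem hl
    · exact Or.inl (List.getD_eq_default _ _ (not_lt.1 hl))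
  refine ⟨fun n => v n.unpair.1 n.unpair.2, ?_, ?_⟩
  · rw [← Nat.cofinite_eq_atTop, Metric.tendsto_nhds]
    intro ε hε
    obtain ⟨I, hI⟩ := eventually_atTop.1 (hr.eventually_lt_const hε)
    -- only the finitely many entries of the lists number `0, …, I` can be large
    have hfin : (⋃ i ∈ Finset.range (I + 1), (Nat.pair i) '' (Set.Iio (L i).length)).Finite :=
      Set.Finite.biUnion (Finset.finite_toSet _) fun i _ => (Set.finite_Iio _).image _
    refine hfin.subset fun n hn => ?_
    simp only [Set.mem_compl_iff, Set.mem_ofPred_eq, dist_zero_right, not_lt] at hn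
    have hne : v n.unpair.1 n.unpair.2 ≠ 0 := fun h => by
      rw [h, norm_zero] at hn
      exact hε.not_ge hn
    simp only [Set.mem_iUnion, Finset.mem_range, exists_prop]
    refine ⟨n.unpair.1, ?_, n.unpair.2, ?_, Nat.pair_unpair n⟩
    · by_contra hlt
      obtain ⟨i, hi⟩ : ∃ i, n.unpair.1 = i + 1 := ⟨n.unpair.1 - 1, by omega⟩
      have hmem := (hv n.unpair.1 n.unpair.2).resolve_left hne
      rw [hi] at hmem hn
      exact ((hFr i _ hmem).trans_lt (hI i (by omega))).not_ge hn
    · by_contra hlt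
      exact hne (List.getD_eq_default _ _ (not_lt.1 hlt))
  · intro i y hy
    have : y ∈ L i := by simpa [L] using hy
    obtain ⟨l, hl, rfl⟩ := List.getElem_of_mem this
    exact ⟨l, by simp [v, hl]⟩

/-- Grothendieck: a compact subset of a Banach space lies in the absolutely convex closed hull of a
null sequence. The successive differences of approximations of a point by finite `4⁻ⁱ`-nets have
norm at most `2 · 4⁻ⁱ`, so that they can be enlarged by the factor `2ⁱ` and still tend to zero. -/
theorem IsCompact.exists_null_seq {Z : Type*} [NormedAddCommGroup Z] [NormedSpace ℂ Z]
    [CompleteSpace Z] {M : Set Z} (hM : IsCompact M) :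
    ∃ z : ℕ → Z, Tendsto z atTop (𝓝 0) ∧
      ∀ m ∈ M, ∃ a : lp (fun _ : ℕ => ℂ) 1, ‖a‖ < 1 ∧ HasSum (fun j => a j • z j) m := by
  have hnet : ∀ i : ℕ, ∃ t ⊆ M, t.Finite ∧ M ⊆ ⋃ x ∈ t, ball x ((1 / 4 : ℝ) ^ i) := fun i =>
    finite_cover_balls_of_compact hM (by positivity)
  choose t htM htf htc using hnet
  -- the coefficients of the differences; the factor `1 / 4` makes their sum less than `1`
  let c : ℕ → ℂ := fun i => (1 / 4 : ℂ) * (1 / 2) ^ i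
  have hc0 : ∀ i, c i ≠ 0 := fun i => by simp [c]
  have hcn : ∀ i, ‖c i‖ = 1 / 4 * (1 / 2) ^ i := fun i => by simp [c]
  let F : ℕ → Set Z := fun i => Nat.casesOn i ((fun y => (c 0)⁻¹ • y) '' t 0) fun i =>
    ((fun p : Z × Z => (c (i + 1))⁻¹ • (p.2 - p.1)) '' (t i ×ˢ t (i + 1))) ∩
      closedBall 0 (16 * (1 / 2) ^ i)
  have hF : ∀ i, (F i).Finite := by
    rintro (_ | i)
    · exact (htf 0).image _
    · exact (((htf i).prod (htf (i + 1))).image _).inter_of_left _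
  obtain ⟨z, hz, hzF⟩ := exists_null_enumeration hF (r := fun i => 16 * (1 / 2) ^ i)
    (by simpa using (tendsto_pow_atTop_nhds_zero_of_lt_one (r := (1 / 2 : ℝ)) (by norm_num)
      (by norm_num)).const_mul 16)
    (fun i y hy => by simpa using hy.2)
  refine ⟨z, hz, fun m hm => ?_⟩
  have hn : ∀ i, ∃ x ∈ t i, dist m x < (1 / 4 : ℝ) ^ i := fun i => by
    simpa using htc i hm
  choose n hnt hnm using hn
  let d : ℕ → Z := fun i => Nat.casesOn i (n 0) fun i => n (i + 1) - n i
  have hdn : ∀ i, ‖d (i + 1)‖ ≤ 2 * (1 / 4) ^ i := fun i => by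
    have h1 := hnm i
    have h2 := hnm (i + 1)
    have h3 : ‖d (i + 1)‖ ≤ dist m (n (i + 1)) + dist m (n i) := by
      rw [show d (i + 1) = n (i + 1) - n i from rfl, ← dist_eq_norm]
      exact dist_triangle_left _ _ _
    have h4 : (1 / 4 : ℝ) ^ (i + 1) ≤ (1 / 4) ^ i := by
      rw [pow_succ]
      have : (0 : ℝ) < (1 / 4) ^ i := by positivity
      linarith
    linarith
  have hdF : ∀ i, (c i)⁻¹ • d i ∈ F i := by
    rintro (_ | i)
    · exact ⟨n 0, hnt 0, rfl⟩
    · refine ⟨⟨(n i, n (i + 1)), ⟨hnt i, hnt (i + 1)⟩, rfl⟩, ?_⟩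
      rw [mem_closedBall, dist_zero_right, norm_smul, norm_inv, hcn]
      calc (1 / 4 * (1 / 2 : ℝ) ^ (i + 1))⁻¹ * ‖d (i + 1)‖
          ≤ (1 / 4 * (1 / 2 : ℝ) ^ (i + 1))⁻¹ * (2 * (1 / 4) ^ i) := by
            gcongr
            exact hdn i
        _ = 16 * (1 / 2) ^ i := by
          rw [show (1 / 4 : ℝ) ^ i = (1 / 2) ^ i * (1 / 2) ^ i by rw [← mul_pow]; norm_num]
          field_simp
          ring
  choose l hl using fun i => hzF i _ (hdF i)
  let g : ℕ → ℕ := fun i => Nat.pair i (l i)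
  have hg : Function.Injective g := fun i j h => (Nat.pair_eq_pair.1 h).1
  have hsupp : ∀ j, j ∉ Set.range g → Function.extend g c 0 j = 0 := fun j hj => by
    rw [Function.extend_apply' _ _ _ (by simpa using hj), Pi.zero_apply]
  have hcs : HasSum (fun i => ‖c i‖) (1 / 2) := by
    simp_rw [hcn]
    convert! hasSum_geometric_two.mul_left (1 / 4 : ℝ) using 1
    norm_num
  have has : HasSum (fun j => ‖Function.extend g c 0 j‖) (1 / 2) := by
    refine (hg.hasSum_iff fun j hj => by rw [hsupp j hj, norm_zero]).1 ?_
    simpa [Function.comp_def, hg.extend_apply] using hcs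
  let a : lp (fun _ : ℕ => ℂ) 1 := ⟨Function.extend g c 0, memℓp_gen (by simpa using has.summable)⟩
  refine ⟨a, ?_, ?_⟩
  · rw [(lp.hasSum_norm_one a).unique has]
    norm_num
  · refine (hg.hasSum_iff fun j hj => ?_).1 ?_
    · change Function.extend g c 0 j • z j = 0
      rw [hsupp j hj, zero_smul]
    · have h1 : (fun j => a j • z j) ∘ g = d := by
        ext i
        change Function.extend g c 0 (g i) • z (g i) = d i
        rw [hg.extend_apply, hl i, smul_inv_smul₀ (hc0 i)]
      have h2 : Summable d := by
        rw [← summable_nat_add_iff 1]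
        refine Summable.of_norm_bounded ?_ hdn
        exact (summable_geometric_of_lt_one (by norm_num) (by norm_num)).mul_left _
      rw [h1, h2.hasSum_iff_tendsto_nat, ← tendsto_add_atTop_iff_nat 1]
      have h3 : ∀ k, ∑ i ∈ Finset.range (k + 1), d i = n k := by
        intro k
        rw [Finset.sum_range_succ', Finset.sum_range_sub n k]
        exact sub_add_cancel _ _
      simp_rw [h3]
      rw [tendsto_iff_dist_tendsto_zero]
      refine squeeze_zero (fun _ => dist_nonneg) (fun k => (dist_comm _ _).trans_le (hnm k).le) ?_
      exact tendsto_pow_atTop_nhds_zero_of_lt_one (by norm_num) (by norm_num)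

end Grothendieck

/-! ### `K_A`-bounded sets and diagonal operators -/

namespace BanachOperatorIdeal

variable {A : BanachOperatorIdeal.{u}} {X : Type u} [NormedAddCommGroup X] [NormedSpace ℂ X]
  [CompleteSpace X]

/-- By Grothendieck's lemma every compact set is contained in the image of the unit ball of `ℓ₁`
under a compact operator. -/
theorem RelCompact.kBounded {K : Set X} (hK : A.RelCompact K) : A.KBounded K := by
  obtain ⟨Z, _, _, _, T, M, hT, hM, hK⟩ := hK
  obtain ⟨z, hz, hzM⟩ := hM.exists_null_seq
  obtain ⟨C, hC⟩ := hz.norm.bddAbove_range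
  have hzC : ∀ j, ‖z j‖ ≤ C := fun j => hC ⟨j, rfl⟩
  obtain ⟨D, hzD, hD, hc, hb⟩ := hz.isCompact_insert_range.exists_compact_disk
  let e : ULift.{u} (lp (fun _ : ℕ => ℂ) 1) ≃L[ℂ] lp (fun _ : ℕ => ℂ) 1 :=
    ContinuousLinearEquiv.ulift
  refine ⟨ULift.{u} (lp (fun _ : ℕ => ℂ) 1), inferInstance, inferInstance, inferInstance,
    (T.comp (lp.sumSMul z C hzC)).comp e.toContinuousLinearMap, ?_, ?_⟩
  · refine ⟨Z, _, _, _, T, D, hT, hD, ?_⟩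
    rintro _ ⟨a, ha, rfl⟩
    rw [mem_ball_zero_iff] at ha
    exact ⟨lp.sumSMul z C hzC a.down, hb.hasSum_lp_mem hc hD.isClosed
      (fun j => hzD (Set.mem_insert_of_mem _ ⟨j, rfl⟩)) ha.le (lp.hasSum_sumSMul hzC a.down), rfl⟩
  · intro x hx
    obtain ⟨m, hm, rfl⟩ := hK hx
    obtain ⟨a, ha, ham⟩ := hzM m hm
    refine ⟨ULift.up a, by rwa [mem_ball_zero_iff], ?_⟩
    exact congrArg T ((lp.hasSum_sumSMul hzC a).unique ham)

/-- The diagonal operator with entries `cⱼ vⱼ` factors through the diagonal operator with the null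
sequence `√|cⱼ|` and the nuclear operator with entries `cⱼ / √|cⱼ| • vⱼ`. -/
theorem relCompact_range_smul {c : ℕ → ℂ} (hc : Summable fun j => √‖c j‖) {v : ℕ → X} {C : ℝ}
    (hv : ∀ j, ‖v j‖ ≤ C) : A.RelCompact (Set.range fun j => c j • v j) := by
  let x : ℕ → X := fun j => (c j / √‖c j‖) • v j
  have hxn : ∀ j, ‖x j‖ ≤ √‖c j‖ * C := fun j => by
    rw [norm_smul, norm_div, Complex.norm_real, Real.norm_of_nonneg (Real.sqrt_nonneg _),
      Real.div_sqrt]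
    exact mul_le_mul_of_nonneg_left (hv j) (Real.sqrt_nonneg _)
  have hxs : Summable fun j => ‖x j‖ :=
    (hc.mul_right C).of_nonneg_of_le (fun _ => norm_nonneg _) hxn
  have hxC : ∀ j, ‖x j‖ ≤ ∑' j, ‖x j‖ := fun j => hxs.le_tsum j fun _ _ => norm_nonneg _
  let e : ULift.{u} (lp (fun _ : ℕ => ℂ) 1) ≃L[ℂ] lp (fun _ : ℕ => ℂ) 1 :=
    ContinuousLinearEquiv.ulift
  let T : ULift.{u} (lp (fun _ : ℕ => ℂ) 1) →L[ℂ] X :=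
    (lp.sumSMul x _ hxC).comp e.toContinuousLinearMap
  have hT : T ∈ A.mem _ X := by
    refine mem_of_hasSum
      (φ := fun j => (lp.evalCLM ℂ (fun _ : ℕ => ℂ) 1 j).comp e.toContinuousLinearMap)
      (fun j => ?_) hxs fun z => lp.hasSum_sumSMul hxC z.down
    refine ContinuousLinearMap.opNorm_le_bound _ zero_le_one fun z => ?_
    rw [one_mul]
    exact lp.norm_apply_le_norm one_ne_zero z.down j
  have hw : Tendsto (fun j => ULift.up.{u} (lp.single (E := fun _ : ℕ => ℂ) 1 j (√‖c j‖ : ℂ)))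
      atTop (𝓝 0) := by
    rw [tendsto_zero_iff_norm_tendsto_zero]
    refine hc.tendsto_atTop_zero.congr fun j => ?_
    rw [ULift.norm_up, lp.norm_single one_pos, Complex.norm_real,
      Real.norm_of_nonneg (Real.sqrt_nonneg _)]
  refine (relCompact_range_of_tendsto hT hw).mono ?_
  rintro _ ⟨j, rfl⟩
  refine ⟨j, (lp.hasSum_sumSMul hxC _).unique ?_⟩
  have hj : c j • v j = lp.single (E := fun _ : ℕ => ℂ) 1 j (√‖c j‖ : ℂ) j • x j := by
    rw [lp.single_apply_self, smul_smul]
    by_cases h : c j = 0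
    · simp [h]
    · rw [mul_div_cancel₀ _ (by simpa using h)]
  change HasSum _ (c j • v j)
  rw [hj]
  refine hasSum_single j fun i hi => ?_
  change lp.single (E := fun _ : ℕ => ℂ) 1 j (√‖c j‖ : ℂ) i • x i = 0
  rw [lp.single_apply_ne _ _ _ hi, zero_smul]

end BanachOperatorIdeal

/-! ### Cauchy's formula for Taylor polynomials -/

section Cauchy

theorem isContHomPolynomial_taylorPolynomial {E F : Type*} [NormedAddCommGroup E]
    [NormedSpace ℂ E] [NormedAddCommGroup F] [NormedSpace ℂ F] (f : E → F) (x : E) (n : ℕ) :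
    IsContHomPolynomial n (taylorPolynomial f x n) :=
  ⟨((n.factorial : ℂ)⁻¹) • iteratedFDeriv ℂ n f x, fun _ => rfl⟩

variable {E F : Type*} [NormedAddCommGroup E] [NormedSpace ℂ E] [NormedAddCommGroup F]
  [NormedSpace ℂ F] [CompleteSpace F]

/-- Cauchy's formula along the complex line through `x` in the direction `y`. -/
theorem taylorPolynomial_eq_circleIntegral {f : E → F} (hf : AnalyticOnNhd ℂ f Set.univ)
    (x y : E) (n : ℕ) :
    taylorPolynomial f x n y = (2 * Real.pi * Complex.I : ℂ)⁻¹ •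
      ∮ z in C(0, 1), (1 / (z - 0)) ^ n • (z - 0)⁻¹ • f (x + z • y) := by
  let u : ℂ →L[ℂ] E := ContinuousLinearMap.toSpanSingleton ℂ y
  obtain ⟨p, hp⟩ := hf x trivial
  have h1 : HasFPowerSeriesAt (fun z : ℂ => f (x + z • y)) (p.compContinuousLinearMap u) 0 := by
    have : HasFPowerSeriesAt (fun w => f (x + w)) p (u 0) := by
      obtain ⟨r, hr⟩ := hp
      have := hr.comp_sub (-x)
      simp only [add_neg_cancel, sub_neg_eq_add, add_comm _ x] at this
      rw [map_zero]
      exact ⟨r, this⟩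
    exact this.compContinuousLinearMap
  have hd : Differentiable ℂ fun z : ℂ => f (x + z • y) := fun z =>
    (hf _ trivial).differentiableAt.comp z (by fun_prop)
  have h2 := (hd.hasFPowerSeriesOnBall 0 (R := 1) one_pos).hasFPowerSeriesAt
  have h3 := congrArg (fun q => q n fun _ => (1 : ℂ)) (h1.eq_formalMultilinearSeries h2)
  simp only [NNReal.coe_one, cauchyPowerSeries_apply] at h3
  rw [taylorPolynomial_eq_of_hasFPowerSeriesAt hp, ← h3]
  change p n _ = p n _
  congr 1
  funext _
  simp [u]

theorem Convex.circleAverage_mem {D : Set F} (hc : Convex ℝ D) (hcl : IsClosed D) {g : ℂ → F}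
    (hg : CircleIntegrable g 0 1) (hD : ∀ z : ℂ, ‖z‖ = 1 → g z ∈ D) :
    Real.circleAverage g 0 1 ∈ D := by
  rw [Real.circleAverage_eq_intervalAverage]
  have h2 : (0 : ℝ) < 2 * Real.pi := Real.two_pi_pos
  rw [Set.uIoc_of_le h2.le]
  refine hc.set_average_mem hcl ?_ ?_ (Eventually.of_forall fun θ => hD _ ?_) ?_
  · simp [Real.pi_pos]
  · exact measure_Ioc_lt_top.ne
  · simp [norm_circleMap_zero]
  · rw [← intervalIntegrable_iff_integrableOn_Ioc_of_le h2.le]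
    exact hg

/-- Cauchy's inequalities for closed disks in place of balls. -/
theorem taylorPolynomial_mem {f : E → F} (hf : AnalyticOnNhd ℂ f Set.univ)
    {D : Set F} (hc : Convex ℝ D) (hb : Balanced ℂ D) (hcl : IsClosed D) {x y : E}
    (hD : ∀ z : ℂ, ‖z‖ = 1 → f (x + z • y) ∈ D) (n : ℕ) : taylorPolynomial f x n y ∈ D := by
  have hfc : Continuous f := continuousOn_univ.1 hf.continuousOn
  rw [taylorPolynomial_eq_circleIntegral hf]
  have h := Real.circleAverage_eq_circleIntegral (R := 1) (c := 0)
    (f := fun z : ℂ => (1 / (z - 0)) ^ n • f (x + z • y)) one_ne_zero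
  simp_rw [smul_comm _ ((_ : ℂ) ^ n)] at h ⊢
  rw [← h]
  refine hc.circleAverage_mem hcl ?_ fun z hz => hb.smul_mem ?_ (hD z hz)
  · refine ContinuousOn.circleIntegrable zero_le_one (ContinuousOn.smul ?_ (by fun_prop))
    refine ContinuousOn.pow (continuousOn_const.div (by fun_prop) fun z hz => ?_) n
    rw [sub_zero]
    exact ne_of_mem_sphere hz one_ne_zero
  · simp [hz]

end Cauchy

/-! ### Taylor coefficients of sums of powers -/

theorem lp.tendsto_norm_apply (x : lp (fun _ : ℕ => ℂ) 1) :
    Tendsto (fun j => ‖x j‖) atTop (𝓝 0) :=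
  (lp.hasSum_norm_one x).summable.tendsto_atTop_zero

theorem lp.exists_pow_le (x : lp (fun _ : ℕ => ℂ) 1) {m : ℕ → ℕ} (hm : Tendsto m atTop atTop) :
    ∃ C, 0 ≤ C ∧ ∀ j, (‖x j‖ + 1 / 4) ^ m j ≤ C := by
  have h : Tendsto (fun j => (‖x j‖ + 1 / 4) ^ m j) atTop (𝓝 0) := by
    have h1 := (tendsto_pow_atTop_nhds_zero_of_lt_one (r := (1 / 2 : ℝ)) (by norm_num)
      (by norm_num)).comp hm
    refine squeeze_zero' (Eventually.of_forall fun j => by positivity) ?_ h1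
    filter_upwards [(lp.tendsto_norm_apply x).eventually_lt_const (u := 1 / 4) (by norm_num)]
      with j hj
    exact pow_le_pow_left₀ (by positivity) (by linarith) _
  obtain ⟨C, hC⟩ := h.bddAbove_range
  exact ⟨C, (by positivity : (0 : ℝ) ≤ (‖x 0‖ + 1 / 4) ^ m 0).trans (hC ⟨0, rfl⟩),
    fun j => hC ⟨j, rfl⟩⟩

theorem hasSum_choose_mul_pow {R : Type*} [CommSemiring R] [TopologicalSpace R] (a y : R) (n : ℕ) :
    HasSum (fun k => (n.choose k : R) * a ^ (n - k) * y ^ k) ((a + y) ^ n) := by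
  have h : (a + y) ^ n =
      ∑ k ∈ Finset.range (n + 1), (n.choose k : R) * a ^ (n - k) * y ^ k := by
    rw [add_comm, add_pow]
    exact Finset.sum_congr rfl fun k _ => by ring
  rw [h]
  refine hasSum_sum_of_ne_finset_zero fun k hk => ?_
  rw [Nat.choose_eq_zero_of_lt (by simpa using hk)]
  simp

/-- The map `a ↦ ∑ aⱼ ^ nⱼ vⱼ` on `ℓ₁`. The series converges absolutely if `v` is bounded, all `nⱼ`
are positive and `nⱼ → ∞`. -/
noncomputable def powerSum {X : Type*} [NormedAddCommGroup X] [NormedSpace ℂ X] (n : ℕ → ℕ)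
    (v : ℕ → X) (a : lp (fun _ : ℕ => ℂ) 1) : X :=
  ∑' j, a j ^ n j • v j

/-- The coefficient of `yⱼ ^ k` in `(xⱼ + yⱼ) ^ nⱼ`. -/
noncomputable def taylorCoeff (n : ℕ → ℕ) (x : lp (fun _ : ℕ => ℂ) 1) (k j : ℕ) : ℂ :=
  (n j).choose k * x j ^ (n j - k)

section Coeff

variable {n : ℕ → ℕ} (x : lp (fun _ : ℕ => ℂ) 1)

theorem norm_taylorCoeff (k j : ℕ) :
    ‖taylorCoeff n x k j‖ = (n j).choose k * ‖x j‖ ^ (n j - k) := by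
  simp [taylorCoeff]

theorem hasSum_taylorCoeff (y : ℂ) (j : ℕ) :
    HasSum (fun k => taylorCoeff n x k j * y ^ k) ((x j + y) ^ n j) :=
  hasSum_choose_mul_pow _ _ _

theorem hasSum_norm_taylorCoeff (t : ℝ) (j : ℕ) :
    HasSum (fun k => ‖taylorCoeff n x k j‖ * t ^ k) ((‖x j‖ + t) ^ n j) := by
  simpa only [norm_taylorCoeff] using hasSum_choose_mul_pow _ _ _

/-- The null sequence `xⱼ` makes `|xⱼ| ^ (nⱼ - k)` small enough to absorb the binomial coefficient
`≤ 2 ^ nⱼ` and still leave a factor `|xⱼ| ^ 2`. -/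
theorem summable_sqrt_taylorCoeff (hn : Tendsto n atTop atTop) (k : ℕ) :
    Summable fun j => √‖taylorCoeff n x k j‖ := by
  refine summable_of_isBigO_nat (lp.hasSum_norm_one x).summable
    (Asymptotics.IsBigO.of_bound (2 ^ (k + 2)) ?_)
  filter_upwards [(lp.tendsto_norm_apply x).eventually_lt_const (u := 1 / 4) (by norm_num),
    hn.eventually_ge_atTop (k + 2)] with j hj hnj
  rw [Real.norm_of_nonneg (Real.sqrt_nonneg _), norm_norm, Real.sqrt_le_left (by positivity),
    norm_taylorCoeff]
  obtain ⟨m, hm⟩ := Nat.exists_eq_add_of_le hnj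
  have h1 : ((n j).choose k : ℝ) ≤ 2 ^ n j := by exact_mod_cast Nat.choose_le_two_pow (n j) k
  have h2 : n j - k = m + 2 := by omega
  calc ((n j).choose k : ℝ) * ‖x j‖ ^ (n j - k) ≤ 2 ^ n j * ((1 / 4) ^ m * ‖x j‖ ^ 2) := by
        rw [h2, pow_add]
        gcongr
    _ = 2 ^ (k + 2) * (1 / 2) ^ m * ‖x j‖ ^ 2 := by
      rw [hm, show (1 / 4 : ℝ) ^ m = (1 / 2) ^ m * (1 / 2) ^ m by rw [← mul_pow]; norm_num,
        pow_add 2 (k + 2) m, one_div, inv_pow]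
      field_simp
    _ ≤ 2 ^ (k + 2) * 2 ^ (k + 2) * ‖x j‖ ^ 2 := by
      gcongr
      exact (pow_le_one₀ (by norm_num) (by norm_num)).trans (one_le_pow₀ (by norm_num))
    _ = (2 ^ (k + 2) * ‖x j‖) ^ 2 := by ring

theorem summable_norm_taylorCoeff (hn : Tendsto n atTop atTop) (k : ℕ) :
    Summable fun j => ‖taylorCoeff n x k j‖ := by
  have h := summable_sqrt_taylorCoeff x hn k
  refine summable_of_isBigO_nat h (Asymptotics.IsBigO.of_bound 1 ?_)
  filter_upwards [h.tendsto_atTop_zero.eventually_lt_const one_pos] with j hj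
  rw [norm_norm, one_mul, Real.norm_of_nonneg (Real.sqrt_nonneg _)]
  calc ‖taylorCoeff n x k j‖ = √‖taylorCoeff n x k j‖ * √‖taylorCoeff n x k j‖ :=
        (Real.mul_self_sqrt (norm_nonneg _)).symm
    _ ≤ √‖taylorCoeff n x k j‖ * 1 := mul_le_mul_of_nonneg_left hj.le (Real.sqrt_nonneg _)
    _ = _ := mul_one _

theorem exists_norm_taylorCoeff_le (hn : Tendsto n atTop atTop) :
    ∃ C, 0 ≤ C ∧ ∀ k j, ‖taylorCoeff n x k j‖ ≤ C * 4 ^ k := by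
  obtain ⟨C, hC0, hC⟩ := lp.exists_pow_le x hn
  refine ⟨C, hC0, fun k j => ?_⟩
  have h := (le_hasSum (hasSum_norm_taylorCoeff (n := n) x (1 / 4) j) k
    fun _ _ => by positivity).trans (hC j)
  rw [one_div, inv_pow, ← div_eq_mul_inv, div_le_iff₀ (by positivity)] at h
  exact h

/-- On the ball of radius `1 / 4` about `x` the sequence `aⱼ ^ nⱼ` is bounded in `ℓ₁`. -/
theorem exists_pow_le_mul (hn : Tendsto n atTop atTop) (hn1 : ∀ j, 1 ≤ n j) :
    ∃ C, 0 ≤ C ∧ ∀ j, ∀ t : ℝ, 0 ≤ t → t ≤ ‖x j‖ + 1 / 4 → t ^ n j ≤ C * t := by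
  obtain ⟨C, hC0, hC⟩ := lp.exists_pow_le x (m := fun j => n j - 1)
    (tendsto_atTop_mono (fun j => le_refl (n j - 1)) ((tendsto_sub_atTop_nat 1).comp hn))
  refine ⟨C, hC0, fun j t ht htx => ?_⟩
  rw [← Nat.sub_add_cancel (hn1 j), pow_succ]
  exact mul_le_mul_of_nonneg_right ((pow_le_pow_left₀ ht htx _).trans (hC j)) ht

end Coeff

/-! ### Taylor series of sums of powers -/

section PowerSum

variable {X : Type*} [NormedAddCommGroup X] [NormedSpace ℂ X]

/-- The `k`-linear map `(y₁, …, yₖ) ↦ y₁ⱼ ⋯ yₖⱼ • w`. -/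
noncomputable def coordMonomial (k j : ℕ) (w : X) : lp (fun _ : ℕ => ℂ) 1 [×k]→L[ℂ] X :=
  ((ContinuousMultilinearMap.mkPiAlgebraFin ℂ k ℂ).compContinuousLinearMap
    fun _ => lp.evalCLM ℂ (fun _ : ℕ => ℂ) 1 j).smulRight w

theorem coordMonomial_apply (k j : ℕ) (w : X) (y : Fin k → lp (fun _ : ℕ => ℂ) 1) :
    coordMonomial k j w y = (∏ i, y i j) • w := by
  change (List.ofFn fun i => y i j).prod • w = _
  rw [List.prod_ofFn]

theorem norm_coordMonomial_le (k j : ℕ) (w : X) : ‖coordMonomial k j w‖ ≤ ‖w‖ := by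
  refine ContinuousMultilinearMap.opNorm_le_bound (norm_nonneg _) fun y => ?_
  rw [coordMonomial_apply, norm_smul, norm_prod, mul_comm]
  gcongr
  exact lp.norm_apply_le_norm one_ne_zero _ _

/-- The Taylor series of `powerSum n v` at `x`; the sum over `j` converges absolutely in the space of
`k`-linear maps if `v` is bounded and `nⱼ → ∞`. -/
noncomputable def powerSumSeries (n : ℕ → ℕ) (v : ℕ → X) (x : lp (fun _ : ℕ => ℂ) 1) :
    FormalMultilinearSeries ℂ (lp (fun _ : ℕ => ℂ) 1) X :=
  fun k => ∑' j, coordMonomial k j (taylorCoeff n x k j • v j)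

variable [CompleteSpace X] {n : ℕ → ℕ} {v : ℕ → X} {C : ℝ}

theorem hasSum_powerSum (hn : Tendsto n atTop atTop) (hn1 : ∀ j, 1 ≤ n j) (hv : ∀ j, ‖v j‖ ≤ C)
    (a : lp (fun _ : ℕ => ℂ) 1) : HasSum (fun j => a j ^ n j • v j) (powerSum n v a) := by
  obtain ⟨K, hK0, hK⟩ := exists_pow_le_mul a hn hn1
  refine (Summable.of_norm_bounded
    (((lp.hasSum_norm_one a).summable.mul_left K).mul_right C) fun j => ?_).hasSum
  rw [norm_smul, norm_pow]
  exact mul_le_mul (hK j _ (norm_nonneg _) (by linarith)) (hv j) (norm_nonneg _) (by positivity)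

theorem hasSum_powerSumSeries (hn : Tendsto n atTop atTop) (hv : ∀ j, ‖v j‖ ≤ C)
    (x : lp (fun _ : ℕ => ℂ) 1) (k : ℕ) (y : Fin k → lp (fun _ : ℕ => ℂ) 1) :
    HasSum (fun j => (∏ i, y i j) • taylorCoeff n x k j • v j) (powerSumSeries n v x k y) := by
  have h : Summable fun j => coordMonomial k j (taylorCoeff n x k j • v j) := by
    refine Summable.of_norm_bounded ((summable_norm_taylorCoeff x hn k).mul_right C) fun j => ?_
    refine (norm_coordMonomial_le _ _ _).trans ?_
    rw [norm_smul]
    exact mul_le_mul_of_nonneg_left (hv j) (norm_nonneg _)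
  have hy := ContinuousMultilinearMap.hasSum_eval h.hasSum y
  simp only [coordMonomial_apply] at hy
  exact hy

/-- The bound uses that `∑ⱼ |y₁ⱼ ⋯ yₖⱼ| ≤ ‖y₁‖ ⋯ ‖yₖ‖`, which fails for `k = 0`. -/
theorem exists_norm_powerSumSeries_le (hn : Tendsto n atTop atTop) (hv : ∀ j, ‖v j‖ ≤ C)
    (x : lp (fun _ : ℕ => ℂ) 1) :
    ∃ K, ∀ k, 1 ≤ k → ‖powerSumSeries n v x k‖ ≤ K * 4 ^ k := by
  have hC : 0 ≤ C := (norm_nonneg _).trans (hv 0)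
  obtain ⟨K, hK0, hK⟩ := exists_norm_taylorCoeff_le (n := n) x hn
  refine ⟨K * C, fun k hk => ?_⟩
  obtain ⟨k, rfl⟩ := Nat.exists_eq_add_of_le' hk
  refine ContinuousMultilinearMap.opNorm_le_bound (by positivity) fun y => ?_
  rw [← (hasSum_powerSumSeries hn hv x (k + 1) y).tsum_eq, Fin.prod_univ_succ]
  refine tsum_of_norm_bounded (((lp.hasSum_norm_one (y 0)).mul_right _).mul_left _) fun j => ?_
  rw [norm_smul, norm_smul, Fin.prod_univ_succ, norm_mul, norm_prod]
  calc ‖y 0 j‖ * (∏ i : Fin k, ‖y i.succ j‖) * (‖taylorCoeff n x (k + 1) j‖ * ‖v j‖)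
      ≤ ‖y 0 j‖ * (∏ i : Fin k, ‖y i.succ‖) * (K * 4 ^ (k + 1) * C) := by
        gcongr
        · exact lp.norm_apply_le_norm one_ne_zero _ _
        · exact hK _ _
        · exact hv j
    _ = _ := by ring

theorem hasFPowerSeriesOnBall_powerSum (hn : Tendsto n atTop atTop) (hn1 : ∀ j, 1 ≤ n j)
    (hv : ∀ j, ‖v j‖ ≤ C) (x : lp (fun _ : ℕ => ℂ) 1) :
    HasFPowerSeriesOnBall (powerSum n v) (powerSumSeries n v x) x ((1 / 4 : NNReal) : ENNReal) where
  r_le := by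
    obtain ⟨K, hK⟩ := exists_norm_powerSumSeries_le hn hv x
    refine FormalMultilinearSeries.le_radius_of_eventually_le _ K ?_
    filter_upwards [eventually_ge_atTop 1] with k hk
    calc ‖powerSumSeries n v x k‖ * ((1 / 4 : NNReal) : ℝ) ^ k
        ≤ K * 4 ^ k * ((1 / 4 : NNReal) : ℝ) ^ k := by
          gcongr
          exact hK k hk
      _ = K := by
        rw [mul_assoc, ← mul_pow]
        norm_num
  r_pos := by simp
  hasSum := by
    intro y hy
    have hy' : ‖y‖ < 1 / 4 := by
      rw [Metric.eball_coe, mem_ball_zero_iff] at hy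
      simpa using hy
    have hyj : ∀ j, ‖y j‖ ≤ 1 / 4 := fun j =>
      (lp.norm_apply_le_norm one_ne_zero y j).trans hy'.le
    obtain ⟨K, hK0, hK⟩ := exists_pow_le_mul x hn hn1
    -- expand the powers `(xⱼ + yⱼ) ^ nⱼ` and sum over `j` first
    let F : ℕ × ℕ → X := fun p => (taylorCoeff n x p.2 p.1 * y p.1 ^ p.2) • v p.1
    have hFn : ∀ j, HasSum (fun k => ‖F (j, k)‖) ((‖x j‖ + ‖y j‖) ^ n j * ‖v j‖) := fun j => by
      simpa only [F, norm_smul, norm_mul, norm_pow] using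
        (hasSum_norm_taylorCoeff (n := n) x ‖y j‖ j).mul_right ‖v j‖
    have hFs : Summable F := by
      refine Summable.of_norm ((summable_prod_of_nonneg fun _ => norm_nonneg _).2
        ⟨fun j => (hFn j).summable, ?_⟩)
      simp_rw [(hFn _).tsum_eq]
      refine Summable.of_nonneg_of_le (fun j => by positivity) (fun j => ?_)
        ((((lp.hasSum_norm_one x).summable.add (lp.hasSum_norm_one y).summable).mul_left
          K).mul_right C)
      exact mul_le_mul (hK j _ (by positivity) (by linarith [hyj j])) (hv j) (norm_nonneg _)
        (by positivity)
    have h1 : HasSum (fun j => (x + y) j ^ n j • v j) (∑' p, F p) :=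
      hFs.hasSum.prod_fiberwise fun j => (hasSum_taylorCoeff (n := n) x (y j) j).smul_const (v j)
    rw [(hasSum_powerSum hn hn1 hv (x + y)).unique h1]
    have h2 : HasSum (F ∘ Prod.swap) (∑' p, F p) := (Equiv.prodComm ℕ ℕ).hasSum_iff.2 hFs.hasSum
    refine h2.prod_fiberwise fun k => ?_
    convert! hasSum_powerSumSeries hn hv x k fun _ => y using 2 with j
    simp [F, smul_smul, mul_comm]

theorem analyticOnNhd_powerSum (hn : Tendsto n atTop atTop) (hn1 : ∀ j, 1 ≤ n j)
    (hv : ∀ j, ‖v j‖ ≤ C) : AnalyticOnNhd ℂ (powerSum n v) Set.univ := fun x _ =>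
  (hasFPowerSeriesOnBall_powerSum hn hn1 hv x).analyticAt

theorem hasSum_taylorPolynomial_powerSum (hn : Tendsto n atTop atTop) (hn1 : ∀ j, 1 ≤ n j)
    (hv : ∀ j, ‖v j‖ ≤ C) (x y : lp (fun _ : ℕ => ℂ) 1) (k : ℕ) :
    HasSum (fun j => y j ^ k • taylorCoeff n x k j • v j)
      (taylorPolynomial (powerSum n v) x k y) := by
  rw [taylorPolynomial_eq_of_hasFPowerSeriesAt
    (hasFPowerSeriesOnBall_powerSum hn hn1 hv x).hasFPowerSeriesAt]
  simpa using hasSum_powerSumSeries hn hv x k fun _ => y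

end PowerSum

/-! ### The counterexample -/

/-- A null sequence still tends to zero after multiplication by `nⱼ ^ nⱼ` if `n` tends to infinity
slowly enough. -/
theorem exists_tendsto_atTop_pow_self_mul {r : ℕ → ℝ} (hr0 : ∀ j, 0 ≤ r j)
    (hr : Tendsto r atTop (𝓝 0)) :
    ∃ n : ℕ → ℕ, Tendsto n atTop atTop ∧ (∀ j, 1 ≤ n j) ∧
      Tendsto (fun j => (n j : ℝ) ^ n j * r j) atTop (𝓝 0) := by
  classical
  let P : ℕ → ℕ → Prop := fun j m => (m : ℝ) ^ m * r j ≤ 1 / m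
  -- the largest admissible exponent up to `j`; it is replaced by `1` where it is `0`
  let n : ℕ → ℕ := fun j => Nat.findGreatest (P j) j
  have hP : ∀ m : ℕ, 1 ≤ m → ∀ᶠ j in atTop, m ≤ j ∧ P j m := fun m hm => by
    have h1 : Tendsto (fun j => (m : ℝ) ^ m * r j) atTop (𝓝 0) := by
      simpa using hr.const_mul ((m : ℝ) ^ m)
    have hm' : (0 : ℝ) < 1 / m := one_div_pos.2 (by exact_mod_cast hm)
    filter_upwards [eventually_ge_atTop m, h1.eventually_le_const hm'] with j hj hj'
    exact ⟨hj, hj'⟩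
  have hn : Tendsto n atTop atTop := by
    refine tendsto_atTop.2 fun m => ?_
    filter_upwards [hP (m + 1) (by omega)] with j hj
    exact (Nat.le_succ m).trans (Nat.le_findGreatest hj.1 hj.2)
  have hmax : ∀ᶠ j in atTop, max 1 (n j) = n j ∧ P j (n j) := by
    filter_upwards [hP 1 le_rfl] with j hj
    exact ⟨max_eq_right (Nat.le_findGreatest hj.1 hj.2), Nat.findGreatest_spec hj.1 hj.2⟩
  refine ⟨fun j => max 1 (n j), tendsto_atTop_mono (fun j => le_max_right 1 (n j)) hn,
    fun j => le_max_left _ _, ?_⟩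
  refine squeeze_zero' (Eventually.of_forall fun j => mul_nonneg (by positivity) (hr0 j)) ?_
    (tendsto_one_div_atTop_nhds_zero_nat.comp hn)
  filter_upwards [hmax] with j hj
  rw [hj.1]
  exact hj.2

namespace BanachOperatorIdeal

/-- If `f` maps the `ε`-ball at `x` into a disk `D`, then `P_k f(x)` maps the unit ball into
`ε⁻ᵏ • D`. -/
theorem compactHolomorphic_subset_polyCompactHolomorphic (A : BanachOperatorIdeal.{u})
    (E : Type v) (X : Type u) [NormedAddCommGroup E] [NormedSpace ℂ E] [NormedAddCommGroup X]
    [NormedSpace ℂ X] [CompleteSpace X] :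
    A.compactHolomorphic E X ⊆ A.polyCompactHolomorphic E X := by
  rintro f ⟨hf, hfA⟩
  refine ⟨hf, fun x k => ⟨isContHomPolynomial_taylorPolynomial f x k, RelCompact.kBounded ?_⟩⟩
  obtain ⟨ε, hε, hK⟩ := hfA x
  obtain ⟨D, hKD, hD, hcl, hc, hb⟩ := hK.exists_disk
  refine (hD.image_smul ((ε : ℂ)⁻¹ ^ k)).mono ?_
  rintro _ ⟨y, hy, rfl⟩
  rw [mem_ball_zero_iff] at hy
  have hε0 : (ε : ℂ) ≠ 0 := by exact_mod_cast hε.ne'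
  refine ⟨taylorPolynomial f x k ((ε : ℂ) • y), ?_, ?_⟩
  · refine taylorPolynomial_mem hf hc hb hcl (fun z hz => hKD ⟨_, ?_, rfl⟩) k
    rw [mem_ball_iff_norm, add_sub_cancel_left, norm_smul, norm_smul, hz, one_mul,
      Complex.norm_real, Real.norm_of_nonneg hε.le]
    exact mul_lt_of_lt_one_right hε hy
  · change (ε : ℂ)⁻¹ ^ k • taylorPolynomial f x k ((ε : ℂ) • y) = _
    rw [taylorPolynomial, taylorPolynomial, ContinuousMultilinearMap.map_smul_univ,
      smul_comm, Fin.prod_const, smul_smul ((ε : ℂ)⁻¹ ^ k), ← mul_pow, inv_mul_cancel₀ hε0,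
      one_pow, one_smul]

section PowerSum

variable {A : BanachOperatorIdeal.{u}} {X : Type u} [NormedAddCommGroup X] [NormedSpace ℂ X]
  [CompleteSpace X] {n : ℕ → ℕ} {v : ℕ → X} {C : ℝ}

theorem compactAt_powerSum (hn : Tendsto n atTop atTop) (hn1 : ∀ j, 1 ≤ n j)
    (hv : ∀ j, ‖v j‖ ≤ C) (hvA : A.RelCompact (Set.range v)) (x : lp (fun _ : ℕ => ℂ) 1) :
    A.CompactAt (powerSum n v) x := by
  obtain ⟨D, hvD, hD, hcl, hc, hb⟩ := hvA.exists_disk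
  obtain ⟨K, hK0, hK⟩ := exists_pow_le_mul x hn hn1
  -- `∑ |aⱼ| ^ nⱼ ≤ ρ` on the ball, and so the values of the map lie in `ρ • D`
  set ρ : ℝ := K * (‖x‖ + 1 / 4) + 1 with hρ
  have hρ0 : 0 < ρ := by positivity
  refine ⟨1 / 4, by norm_num, (hD.image_smul (ρ : ℂ)).mono ?_⟩
  rintro _ ⟨a, ha, rfl⟩
  rw [mem_ball_iff_norm] at ha
  have hax : ‖a‖ ≤ ‖x‖ + 1 / 4 := by
    linarith [norm_le_norm_add_norm_sub' a x]
  have haj : ∀ j, ‖a j‖ ^ n j ≤ K * ‖a j‖ := fun j => by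
    refine hK j _ (norm_nonneg _) ?_
    have h1 : ‖a j - x j‖ ≤ ‖a - x‖ := lp.norm_apply_le_norm one_ne_zero (a - x) j
    linarith [norm_le_norm_add_norm_sub' (a j) (x j)]
  have hρ0' : (ρ : ℂ) ≠ 0 := by exact_mod_cast hρ0.ne'
  refine ⟨(ρ : ℂ)⁻¹ • powerSum n v a, ?_, smul_inv_smul₀ hρ0' _⟩
  have hs := (hasSum_powerSum hn hn1 hv a).const_smul (ρ : ℂ)⁻¹
  simp_rw [smul_smul] at hs
  refine hb.hasSum_smul_mem hc hcl ⟨_, hvD ⟨0, rfl⟩⟩ (fun j => hvD ⟨j, rfl⟩) (fun s => ?_) hs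
  simp_rw [norm_mul, norm_inv, norm_pow, Complex.norm_real, Real.norm_of_nonneg hρ0.le]
  rw [← Finset.mul_sum, inv_mul_le_iff₀ hρ0, mul_one]
  calc ∑ j ∈ s, ‖a j‖ ^ n j ≤ ∑ j ∈ s, K * ‖a j‖ := Finset.sum_le_sum fun j _ => haj j
    _ = K * ∑ j ∈ s, ‖a j‖ := by rw [Finset.mul_sum]
    _ ≤ K * (‖x‖ + 1 / 4) := by
      gcongr
      exact (sum_le_hasSum s (fun _ _ => norm_nonneg _) (lp.hasSum_norm_one a)).trans hax
    _ ≤ ρ := by linarith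

theorem powerSum_mem_polyCompactHolomorphic (hn : Tendsto n atTop atTop) (hn1 : ∀ j, 1 ≤ n j)
    (hv : ∀ j, ‖v j‖ ≤ C) :
    powerSum n v ∈ A.polyCompactHolomorphic (lp (fun _ : ℕ => ℂ) 1) X := by
  refine ⟨analyticOnNhd_powerSum hn hn1 hv, fun x k =>
    ⟨isContHomPolynomial_taylorPolynomial _ x k, RelCompact.kBounded ?_⟩⟩
  -- the polynomial of degree `0` is constant; for `k ≥ 1` also `yⱼ ^ k` is in the ball of `ℓ₁`
  rcases Nat.eq_zero_or_pos k with rfl | hk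
  · refine (relCompact_singleton (taylorPolynomial (powerSum n v) x 0 0)).mono ?_
    rintro _ ⟨y, -, rfl⟩
    refine congrArg (fun w => _ • iteratedFDeriv ℂ 0 (powerSum n v) x w) ?_
    exact Subsingleton.elim _ _
  · obtain ⟨D, hD', hD, hcl, hc, hb⟩ :=
      (relCompact_range_smul (A := A) (summable_sqrt_taylorCoeff x hn k) hv).exists_disk
    refine hD.mono ?_
    rintro _ ⟨y, hy, rfl⟩
    rw [mem_ball_zero_iff] at hy
    refine hb.hasSum_smul_mem hc hcl ⟨_, hD' ⟨0, rfl⟩⟩ (fun j => hD' ⟨j, rfl⟩) (fun s => ?_)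
      (hasSum_taylorPolynomial_powerSum hn hn1 hv x y k)
    calc ∑ j ∈ s, ‖y j ^ k‖ ≤ ∑ j ∈ s, ‖y j‖ := by
          refine Finset.sum_le_sum fun j _ => ?_
          rw [norm_pow]
          exact pow_le_of_le_one (norm_nonneg _)
            ((lp.norm_apply_le_norm one_ne_zero y j).trans hy.le) hk.ne'
      _ ≤ 1 := (sum_le_hasSum s (fun _ _ => norm_nonneg _) (lp.hasSum_norm_one y)).trans hy.le

/-- Moving the `j`-th coordinate of `x` by `ε / 2` changes the value by `cⱼ nⱼ ^ nⱼ tⱼ`, where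
`|cⱼ| ≥ (ε / 8) ^ nⱼ ≥ nⱼ ^ (-nⱼ)` for large `j`. -/
theorem not_compactAt_powerSum (hn : Tendsto n atTop atTop) (hn1 : ∀ j, 1 ≤ n j) {t : ℕ → X}
    (ht : ¬ A.RelCompact (Set.range t)) (hv : ∀ j, ‖v j‖ ≤ C)
    (hvt : ∀ j, v j = (n j : ℂ) ^ n j • t j) (x : lp (fun _ : ℕ => ℂ) 1) :
    ¬ A.CompactAt (powerSum n v) x := by
  rintro ⟨ε, hε, hK⟩
  obtain ⟨D, hKD, hD, hcl, hc, hb⟩ := hK.exists_disk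
  let c : ℕ → ℂ := fun j => (x j + (ε / 2 : ℝ)) ^ n j - x j ^ n j
  -- half the difference of two elements of the disk `D` lies in `D`
  have hdiff : ∀ j, (1 / 2 : ℂ) • c j • v j ∈ D := fun j => by
    let e := lp.single (E := fun _ : ℕ => ℂ) 1 j ((ε / 2 : ℝ) : ℂ)
    have he : x + e ∈ ball x ε := by
      rw [mem_ball_iff_norm, add_sub_cancel_left, lp.norm_single one_pos, Complex.norm_real,
        Real.norm_of_nonneg (by positivity)]
      linarith
    have h1 : powerSum n v (x + e) - powerSum n v x = c j • v j := by
      refine ((hasSum_powerSum hn hn1 hv (x + e)).sub (hasSum_powerSum hn hn1 hv x)).unique ?_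
      have h2 : c j • v j = (x + e) j ^ n j • v j - x j ^ n j • v j := by
        rw [← sub_smul, lp.coeFn_add, Pi.add_apply, lp.single_apply_self]
      rw [h2]
      refine hasSum_single j fun i hi => ?_
      rw [lp.coeFn_add, Pi.add_apply, lp.single_apply_ne _ _ _ hi, add_zero, sub_self]
    have h3 := hb.sum_smul_mem hc ⟨_, hKD ⟨_, he, rfl⟩⟩ Finset.univ ![(1 / 2 : ℂ), -(1 / 2)]
      ![powerSum n v (x + e), powerSum n v x] (by
        intro i _
        fin_cases i
        · exact hKD ⟨_, he, rfl⟩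
        · exact hKD ⟨_, mem_ball_self hε, rfl⟩) (by norm_num [Fin.sum_univ_two])
    rw [← h1]
    simpa [Fin.sum_univ_two, smul_sub, sub_eq_add_neg] using h3
  have hev : ∀ᶠ j in atTop, t j ∈ (fun y => (2 : ℂ) • y) '' D := by
    filter_upwards [(lp.tendsto_norm_apply x).eventually_lt_const (u := ε / 8) (by positivity),
      (tendsto_natCast_atTop_atTop.comp hn).eventually_ge_atTop (8 / ε)] with j hxj hnj
    simp only [Function.comp_apply] at hnj
    rw [div_le_iff₀ hε] at hnj
    have h1 : (ε / 8) ^ n j ≤ ‖c j‖ := by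
      have h2 : 3 * ε / 8 ≤ ‖x j + (ε / 2 : ℝ)‖ := by
        have h3 := norm_sub_le (x j + (ε / 2 : ℝ)) (x j)
        rw [add_sub_cancel_left, Complex.norm_real, Real.norm_of_nonneg (by positivity)] at h3
        linarith
      have h3 : ‖x j + (ε / 2 : ℝ)‖ ^ n j - ‖x j‖ ^ n j ≤ ‖c j‖ := by
        rw [← norm_pow, ← norm_pow]
        exact norm_sub_norm_le _ _
      have h4 : ‖x j‖ ^ n j ≤ (ε / 8) ^ n j := pow_le_pow_left₀ (norm_nonneg _) hxj.le _
      have h5 : (3 * ε / 8) ^ n j ≤ ‖x j + (ε / 2 : ℝ)‖ ^ n j :=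
        pow_le_pow_left₀ (by positivity) h2 _
      have h6 : (3 : ℝ) ≤ 3 ^ n j := le_self_pow₀ (by norm_num) (Nat.one_le_iff_ne_zero.1 (hn1 j))
      have h7 : (3 * ε / 8) ^ n j = 3 ^ n j * (ε / 8) ^ n j := by rw [← mul_pow, mul_div_assoc]
      have h8 : 0 < (ε / 8) ^ n j := by positivity
      nlinarith
    have h2 : 1 ≤ ‖c j * (n j : ℂ) ^ n j‖ := by
      rw [norm_mul, norm_pow, Complex.norm_natCast]
      calc (1 : ℝ) ≤ (ε / 8 * n j) ^ n j := one_le_pow₀ (by linarith)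
        _ = (ε / 8) ^ n j * (n j : ℝ) ^ n j := mul_pow _ _ _
        _ ≤ _ := by gcongr
    have h0 : c j * (n j : ℂ) ^ n j ≠ 0 := norm_pos_iff.1 (one_pos.trans_le h2)
    refine ⟨(c j * (n j : ℂ) ^ n j)⁻¹ • (1 / 2 : ℂ) • c j • v j, hb.smul_mem ?_ (hdiff j), ?_⟩
    · rw [norm_inv]
      exact inv_le_one_of_one_le₀ h2
    · change (2 : ℂ) • _ = _
      rw [hvt, smul_smul (c j), smul_comm (1 / 2 : ℂ), inv_smul_smul₀ h0, smul_smul]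
      norm_num
  obtain ⟨J, hJ⟩ := eventually_atTop.1 hev
  refine ht (((hD.image_smul 2).union
    (relCompact_of_finite ((Set.finite_Iio J).image t))).mono ?_)
  rintro _ ⟨j, rfl⟩
  rcases lt_or_ge j J with h | h
  · exact Or.inr ⟨j, h, rfl⟩
  · exact Or.inl (hJ j h)

end PowerSum

end BanachOperatorIdeal

theorem mainTheorem4 {X : Type u} [NormedAddCommGroup X] [NormedSpace ℂ X] [CompleteSpace X]
    (A B : BanachOperatorIdeal.{u})
    (hAB : ∃ K : Set X, B.RelCompact K ∧ ¬ A.RelCompact K) :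
    (∃ f : lp (fun _ : ℕ => ℂ) 1 → X,
      f ∈ B.compactHolomorphic (lp (fun _ : ℕ => ℂ) 1) X ∧
      f ∈ A.polyCompactHolomorphic (lp (fun _ : ℕ => ℂ) 1) X ∧
      ∀ z : lp (fun _ : ℕ => ℂ) 1, ¬ A.CompactAt f z) ∧
    A.compactHolomorphic (lp (fun _ : ℕ => ℂ) 1) X ⊂
      A.polyCompactHolomorphic (lp (fun _ : ℕ => ℂ) 1) X := by
  obtain ⟨K, ⟨Z, _, _, _, T, M, hT, hM, hK⟩, hKA⟩ := hAB
  obtain ⟨z, hz, hzM⟩ := hM.exists_null_seq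
  have hzA : ¬ A.RelCompact (Set.range fun j => T (z j)) := fun h => by
    obtain ⟨D, hzD, hD, hcl, hc, hb⟩ := h.exists_disk
    refine hKA (hD.mono fun y hy => ?_)
    obtain ⟨m, hm, rfl⟩ := hK hy
    obtain ⟨a, ha, ham⟩ := hzM m hm
    have hTm := T.hasSum ham
    simp only [map_smul] at hTm
    exact hb.hasSum_lp_mem hc hcl (fun j => hzD ⟨j, rfl⟩) ha.le hTm
  obtain ⟨n, hn, hn1, hnz⟩ :=
    exists_tendsto_atTop_pow_self_mul (fun j => norm_nonneg (z j)) (by simpa using hz.norm)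
  have hw : Tendsto (fun j => (n j : ℂ) ^ n j • z j) atTop (𝓝 0) := by
    rw [tendsto_zero_iff_norm_tendsto_zero]
    simpa only [norm_smul, norm_pow, Complex.norm_natCast] using hnz
  let v : ℕ → X := fun j => T ((n j : ℂ) ^ n j • z j)
  obtain ⟨C, hC⟩ := ((T.continuous.tendsto 0).comp hw).norm.bddAbove_range
  have hv : ∀ j, ‖v j‖ ≤ C := fun j => hC ⟨j, rfl⟩
  have hpoly := BanachOperatorIdeal.powerSum_mem_polyCompactHolomorphic (A := A) hn hn1 hv
  have hnot := BanachOperatorIdeal.not_compactAt_powerSum (v := v) hn hn1 hzA hv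
    fun j => map_smul T _ _
  refine ⟨⟨powerSum n v, ⟨analyticOnNhd_powerSum hn hn1 hv, fun x =>
    BanachOperatorIdeal.compactAt_powerSum hn hn1 hv
      (BanachOperatorIdeal.relCompact_range_of_tendsto hT hw) x⟩, hpoly, hnot⟩, ?_⟩
  exact ⟨A.compactHolomorphic_subset_polyCompactHolomorphic _ _,
    fun h => hnot 0 ((h hpoly).2 0)⟩
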